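/- Consider a base station serving $M\ge 1$ clients over unreliable channels. Time is divided into frames $k=1,2,\dots$ of $T\ge 1$ slots. At the beginning of every frame a new packet for each client replaces any undelivered one. In each slot the base station idles or transmits the packet of one client $i$ whose packet of the current frame is still undelivered; the transmission succeeds with probability $p_i\in(0,1]$, independently of the past, and success or failure is observed immediately. Let $h_{1,i}\ge 1$ be given integers, and let $h_{k+1,i}=1$ if client $i$ received a packet in frame $k$ and $h_{k+1,i}=h_{k,i}+1$ otherwise. With weights $\alpha_i>0$, the expected weighted sum age of information of a policy $\pi$ over $K$ frames is $$\mathrm{EWSAoI}_K^\pi=\frac{1}{KTM}\,\mathbb E\Big[\sum_{k=1}^K\sum_{i=1}^M\alpha_i\Big(\frac{T^2}{2}+T^2h_{k,i}\Big)\Big].$$ Let $\Pi$ be the class of all (possibly randomized) non-anticipative policies, and put $V^\pi=\liminf_{K\to\infty}\mathrm{EWSAoI}_K^\pi$. A Greedy policy $G$ schedules in each slot a client with the largest $h_{k,i}$ among those with an undelivered packet (ties broken arbitrarily) and idles only if no packet is left. Let $$\rho^G=\frac{\big(\sum_i\alpha_i\big)\big(\sum_i\frac1{p_i}\big)\big[1+\frac{C_V^2}{M}\big]+T\sum_i\alpha_i}{\big(\sum_i\sqrt{\alpha_i/p_i}\big)^2+T\sum_i\alpha_i},$$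 where $C_V=\sqrt{\bar{\mathbb V}}/\bar{\mathbb M}$ with $\bar{\mathbb M}=\frac1M\sum_j\frac1{p_j}$ and $\bar{\mathbb V}=\frac1M\sum_j\big(\frac1{p_j}-\bar{\mathbb M}\big)^2$. Call the network symmetric if all $\alpha_i$ are equal and all $p_i$ are equal. 1. For every $M,T\ge1$: $\rho^G=1$ if and only if the network is symmetric. 2. In every symmetric network ($M,T\ge 1$) and for every initial vector $h_1$, every Greedy policy $G$ belongs to $\Pi$, the limit $\lim_{K\to\infty}\mathrm{EWSAoI}_K^G=V^G$ exists and is finite, and $V^G\le V^\pi$ for all $\pi\in\Pi$. 3. Consequently Greedy is asymptotically optimal as $M\to\infty$: if $T$, $p$, $\alpha$ are fixed and, for each $M$, $G_M$ is a Greedy policy in the symmetric network with $M$ clients (with any initial vector), then $V^{G_M}/\inf_{\pi\in\Pi}V^\pi\to 1$ as $M\to\infty$. -/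

import Mathlib

open Filter Topology
open scoped ENNReal NNReal

noncomputable section

namespace AoI

/-- A broadcast network with `M` clients and `T` slots per frame: client `i` has channel
reliability `p i ∈ (0, 1]` and weight `α i > 0`. -/
structure Network (M T : ℕ) where
  p : Fin M → ℝ
  p_pos : ∀ i, 0 < p i
  p_le_one : ∀ i, p i ≤ 1
  α : Fin M → ℝ
  α_pos : ∀ i, 0 < α i

/-- What happens in one slot: the scheduled client (`none` if the base station idles), and
the feedback (`true` if the packet was delivered). -/
abbrev Slot (M : ℕ) := Option (Fin M) × Bool

/-- The slots elapsed so far, in chronological order. With frames numbered from `0`, slot number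
`k * T + n` (`n < T`) is the `n`-th slot of frame `k`, and the slot to come after the history `ω`
belongs to frame `ω.length / T`. -/
abbrev History (M : ℕ) := List (Slot M)

/-- Client `i` has received its packet of frame `k` in the course of the history `ω`. -/
def Delivered {M : ℕ} (T : ℕ) (ω : History M) (k : ℕ) (i : Fin M) : Prop :=
  ∃ n < T, ω[k * T + n]? = some (some i, true)

open Classical in
/-- `age T h₁ ω k i`: the number of frames since the last delivery to client `i`, at the beginning
of frame `k`; `h₁` is the vector of initial values. -/
def age {M : ℕ} (T : ℕ) (h₁ : Fin M → ℕ) (ω : History M) : ℕ → Fin M → ℕ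
  | 0, i => h₁ i
  | k + 1, i => if Delivered T ω k i then 1 else age T h₁ ω k i + 1

/-- A non-anticipative, possibly randomized, scheduling rule: from the history of decisions and
feedback, a law for the next decision. -/
abbrev Policy (M : ℕ) := History M → PMF (Option (Fin M))

/-- An admissible policy either idles or selects a client whose packet of the current frame is
still undelivered. -/
def Admissible {M : ℕ} (T : ℕ) (π : Policy M) : Prop :=
  ∀ (ω : History M) (i : Fin M), some i ∈ (π ω).support → ¬ Delivered T ω (ω.length / T) i

/-- A Greedy policy: in each slot it selects, among the clients with an undelivered packet, one
with the highest value of `age` (ties broken arbitrarily); it idles only if there is none. -/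
def IsGreedy {M : ℕ} (T : ℕ) (h₁ : Fin M → ℕ) (π : Policy M) : Prop :=
  ∀ ω : History M,
    (∀ i, some i ∈ (π ω).support →
      ¬ Delivered T ω (ω.length / T) i ∧
        ∀ j, ¬ Delivered T ω (ω.length / T) j →
          age T h₁ ω (ω.length / T) j ≤ age T h₁ ω (ω.length / T) i) ∧
    (none ∈ (π ω).support → ∀ i, Delivered T ω (ω.length / T) i)

namespace Network

variable {M T : ℕ} (N : Network M T)

/-- The feedback of a slot: a transmission to client `i` succeeds with probability `p i`. -/
def feedback : Option (Fin M) → PMF Bool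
  | none => PMF.pure false
  | some i => PMF.ofFintype
      (fun b => if b then ENNReal.ofReal (N.p i) else ENNReal.ofReal (1 - N.p i)) (by
        rw [Fintype.sum_bool]
        simp only [if_true, Bool.false_eq_true, if_false]
        rw [← ENNReal.ofReal_add (N.p_pos i).le (sub_nonneg.2 (N.p_le_one i))]
        simp)

/-- The law of the history of the first `n` slots under the policy `π`. -/
def law (π : Policy M) : ℕ → PMF (History M)
  | 0 => PMF.pure []
  | n + 1 => (law π n).bind fun ω => (π ω).bind fun a =>
      (N.feedback a).map fun s => ω ++ [(a, s)]

/-- The time-averaged weighted sum of the ages of information over the first `K` frames. -/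
def sumAoI (h₁ : Fin M → ℕ) (K : ℕ) (ω : History M) : ℝ :=
  (1 / ((K : ℝ) * T * M)) * ∑ k ∈ Finset.range K, ∑ i,
    N.α i * ((T : ℝ) ^ 2 / 2 + (T : ℝ) ^ 2 * age T h₁ ω k i)

/-- The expected weighted sum age of information over `K` frames (the expectation of a
nonnegative random variable, with values in `[0, ∞]`). -/
def EWSAoI (h₁ : Fin M → ℕ) (π : Policy M) (K : ℕ) : ℝ≥0∞ :=
  ∑' ω, N.law π (K * T) ω * ENNReal.ofReal (N.sumAoI h₁ K ω)

/-- The infinite-horizon expected weighted sum age of information. -/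
def EWSAoILim (h₁ : Fin M → ℕ) (π : Policy M) : ℝ≥0∞ :=
  liminf (fun K => N.EWSAoI h₁ π K) atTop

/-- The optimal infinite-horizon expected weighted sum age of information over all admissible
policies. -/
def optEWSAoI (h₁ : Fin M → ℕ) : ℝ≥0∞ :=
  ⨅ (π : Policy M) (_ : Admissible T π), N.EWSAoILim h₁ π

/-- Sample mean of `1 / p i`. -/
def meanInv : ℝ := (1 / (M : ℝ)) * ∑ j, 1 / N.p j

/-- Sample variance of `1 / p i`. -/
def varInv : ℝ := (1 / (M : ℝ)) * ∑ j, (1 / N.p j - N.meanInv) ^ 2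

/-- Coefficient of variation of `1 / p i`. -/
def CV : ℝ := √N.varInv / N.meanInv

/-- The performance guarantee `ρ^G` of the Greedy policy. -/
def rhoG : ℝ :=
  ((∑ i, N.α i) * (∑ i, 1 / N.p i) * (1 + N.CV ^ 2 / M) + T * ∑ i, N.α i) /
    ((∑ i, √(N.α i / N.p i)) ^ 2 + T * ∑ i, N.α i)

/-- All clients have the same weight and the same channel reliability. -/
def IsSymmetric : Prop :=
  (∀ i j, N.α i = N.α j) ∧ (∀ i j, N.p i = N.p j)

end Network

end AoI

end

open Filter Topology
open scoped ENNReal NNReal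

namespace AoI

/-! ### Deficits of binomial counts -/

/-! For a threshold `x ≥ 1`, follow the number of clients whose residual age is at least `x`,
raising the threshold by one at each frame boundary. All residual ages also grow by one there, so
the count changes only through a successful transmission, which lowers it by at most one. With equal
reliabilities, the count after `n` slots started from `c` is therefore, in expectation, at least
`deficit q n c`. Greedy serves a client of maximal age, which lies in every nonempty level set, so
it attains this bound at all thresholds at once (`deficit_level_le_step`, `step_deficit_level`).

The sum of the ages is the sum of the levels over thresholds (`tsum_level`), so with equal weights
Greedy is optimal over every finite horizon. At the start of each frame all ages are at least one,
so the level at threshold 1 is `M`. Restarting from there gives the Greedy levels in closed form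
(`greedyLevel`), and their sum converges because the deficits are summable.

The claim on `rhoG` is the equality case of Cauchy–Schwarz together with `CV = 0`. The asymptotic
claim is immediate: the ratio equals 1 for every `M ≥ 1`. -/

/-- The expectation of `(c - X)⁺`, where `X` is binomial with parameters `n` and `q`. -/
noncomputable def deficit (q : ℝ≥0∞) : ℕ → ℕ → ℝ≥0∞
  | 0, c => c
  | n + 1, c => q * deficit q n (c - 1) + (1 - q) * deficit q n c

@[simp] lemma deficit_zero_right (q : ℝ≥0∞) (n : ℕ) : deficit q n 0 = 0 := by
  induction n with
  | zero => simp [deficit]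
  | succ n ih => simp [deficit, ih]

lemma deficit_mono (q : ℝ≥0∞) (n : ℕ) : Monotone (deficit q n) := by
  induction n with
  | zero => exact fun a b h => by simpa [deficit] using h
  | succ n ih =>
    intro a b h
    simp only [deficit]
    gcongr <;> apply ih <;> omega

lemma deficit_succ_le {q : ℝ≥0∞} (hq : q ≤ 1) (n c : ℕ) :
    deficit q (n + 1) c ≤ deficit q n c :=
  calc deficit q (n + 1) c ≤ q * deficit q n c + (1 - q) * deficit q n c := by
        simp only [deficit]
        gcongr
        exact deficit_mono q n (Nat.sub_le c 1)
    _ = deficit q n c := by rw [← add_mul, add_tsub_cancel_of_le hq, one_mul]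

/-- The deficit at time `m` counts the `j ≤ c` whose `j`-th success has not yet occurred. That
success takes `j / q` trials on average, and these means add up to `c (c + 1) / (2 q)`. -/
lemma sum_deficit_le {q : ℝ≥0∞} (hq : q ≤ 1) (n c : ℕ) :
    2 * q * ∑ m ∈ Finset.range n, deficit q m c ≤ c * (c + 1) := by
  induction n generalizing c with
  | zero => simp
  | succ n ih =>
    obtain _ | c := c
    · simp
    rw [Finset.sum_range_succ']
    have h : ∑ m ∈ Finset.range n, deficit q (m + 1) (c + 1) =
        q * ∑ m ∈ Finset.range n, deficit q m c +
          (1 - q) * ∑ m ∈ Finset.range n, deficit q m (c + 1) := by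
      simp only [deficit, Finset.sum_add_distrib, Finset.mul_sum, Nat.add_sub_cancel]
    rw [h]
    calc 2 * q * (q * ∑ m ∈ Finset.range n, deficit q m c +
          (1 - q) * ∑ m ∈ Finset.range n, deficit q m (c + 1) + deficit q 0 (c + 1))
        = q * (2 * q * ∑ m ∈ Finset.range n, deficit q m c) +
          (1 - q) * (2 * q * ∑ m ∈ Finset.range n, deficit q m (c + 1)) +
            2 * q * ((c + 1 : ℕ) : ℝ≥0∞) := by
          simp only [deficit]; ring
      _ ≤ q * (c * (c + 1)) + (1 - q) * ((c + 1 : ℕ) * ((c + 1 : ℕ) + 1)) +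
            2 * q * ((c + 1 : ℕ) : ℝ≥0∞) := by
          gcongr ?_ + ?_ + _
          · exact mul_le_mul_right (ih c) q
          · exact mul_le_mul_right (ih (c + 1)) (1 - q)
      _ = (q + (1 - q)) * ((c + 1 : ℕ) * ((c + 1 : ℕ) + 1)) := by
          push_cast; ring
      _ = _ := by rw [add_tsub_cancel_of_le hq, one_mul]

lemma tsum_deficit_ne_top {q : ℝ≥0∞} (hq₀ : q ≠ 0) (hq : q ≤ 1) (c : ℕ) :
    ∑' n, deficit q n c ≠ ⊤ := by
  intro h
  have h₁ : ∑' n, 2 * q * deficit q n c ≤ c * (c + 1) :=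
    ENNReal.tsum_le_of_sum_range_le fun n => by
      rw [← Finset.mul_sum]; exact sum_deficit_le hq n c
  rw [ENNReal.tsum_mul_left, h, ENNReal.mul_top (by simp [hq₀]), top_le_iff] at h₁
  exact (by exact_mod_cast ENNReal.natCast_ne_top (c * (c + 1)) :
    (c : ℝ≥0∞) * (c + 1) ≠ ⊤) h₁

lemma tsum_deficit_mul_ne_top {q : ℝ≥0∞} (hq₀ : q ≠ 0) (hq : q ≤ 1) (c : ℕ) {T : ℕ}
    (hT : 1 ≤ T) : ∑' j, deficit q (j * T) c ≠ ⊤ :=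
  ne_top_of_le_ne_top (tsum_deficit_ne_top hq₀ hq c)
    (ENNReal.tsum_comp_le_tsum_of_injective
      (fun _ _ h => Nat.eq_of_mul_eq_mul_right hT h) fun n => deficit q n c)

/-! ### Ages along a history -/

section History

variable {M T : ℕ} {h₁ : Fin M → ℕ}

lemma delivered_append {ω l : History M} {k : ℕ} (h : (k + 1) * T ≤ ω.length) (i : Fin M) :
    Delivered T (ω ++ l) k i ↔ Delivered T ω k i := by
  refine exists_congr fun n => and_congr_right fun hn => ?_
  rw [List.getElem?_append_left]
  rw [add_mul] at h
  omega

lemma age_append {ω l : History M} {k : ℕ} (h : k * T ≤ ω.length) (i : Fin M) :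
    age T h₁ (ω ++ l) k i = age T h₁ ω k i := by
  induction k with
  | zero => rfl
  | succ k ih =>
    have hd := delivered_append (l := l) h i
    simp only [age, ih (le_trans (Nat.mul_le_mul_right T k.le_succ) h)]
    split_ifs <;> simp_all

lemma not_delivered_of_length_le {ω : History M} {k : ℕ} (h : ω.length ≤ k * T) (i : Fin M) :
    ¬ Delivered T ω k i := by
  rintro ⟨n, -, hn⟩
  rw [List.getElem?_eq_none (by omega)] at hn
  simp at hn

lemma delivered_append_singleton (hT : 1 ≤ T) (ω : History M) (a : Slot M) (i : Fin M) :
    Delivered T (ω ++ [a]) (ω.length / T) i ↔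
      Delivered T ω (ω.length / T) i ∨ a = (some i, true) := by
  have hdm := Nat.div_add_mod' ω.length T
  constructor
  · rintro ⟨n, hn, h⟩
    rcases lt_trichotomy (ω.length / T * T + n) ω.length with hlt | heq | hgt
    · rw [List.getElem?_append_left hlt] at h
      exact Or.inl ⟨n, hn, h⟩
    · rw [heq] at h
      right
      simpa using h
    · rw [List.getElem?_eq_none (by simp; omega)] at h
      simp at h
  · rintro (⟨n, hn, h⟩ | h)
    · refine ⟨n, hn, ?_⟩
      obtain ⟨hlt, -⟩ := List.getElem?_eq_some_iff.1 h
      rw [List.getElem?_append_left hlt, h]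
    · refine ⟨ω.length % T, Nat.mod_lt _ hT, ?_⟩
      rw [hdm, h]
      simp

lemma one_le_age (hh : ∀ i, 1 ≤ h₁ i) (ω : History M) (k : ℕ) (i : Fin M) :
    1 ≤ age T h₁ ω k i := by
  cases k with
  | zero => exact hh i
  | succ k => simp only [age]; split_ifs <;> omega

open Classical in
/-- The age of client `i` in the current frame, reset to zero as soon as the packet of this frame
is delivered. -/
noncomputable def residual (T : ℕ) (h₁ : Fin M → ℕ) (ω : History M) (i : Fin M) : ℕ :=
  if Delivered T ω (ω.length / T) i then 0 else age T h₁ ω (ω.length / T) i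

lemma residual_nil (i : Fin M) : residual T h₁ [] i = h₁ i := by
  have : ¬ Delivered T ([] : History M) 0 i := not_delivered_of_length_le (by simp) i
  simp [residual, this, age]

lemma residual_of_length_eq (hT : 1 ≤ T) {ω : History M} {k : ℕ} (h : ω.length = k * T)
    (i : Fin M) : residual T h₁ ω i = age T h₁ ω k i := by
  have hk : ω.length / T = k := by rw [h, Nat.mul_div_cancel _ hT]
  rw [residual, hk, if_neg (not_delivered_of_length_le h.le i)]

/-- Resetting at delivery rather than at the end of the frame makes the boundary update the same for
all clients: everyone gains one. -/
lemma residual_append (hT : 1 ≤ T) (ω : History M) (a : Slot M) (i : Fin M) :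
    residual T h₁ (ω ++ [a]) i =
      (if a = (some i, true) then 0 else residual T h₁ ω i) +
        if T ∣ ω.length + 1 then 1 else 0 := by
  have hdel := delivered_append_singleton hT ω a i
  have hage : age T h₁ (ω ++ [a]) (ω.length / T) i = age T h₁ ω (ω.length / T) i :=
    age_append (Nat.div_mul_le_self _ _) i
  have hlen : (ω ++ [a]).length = ω.length + 1 := by simp
  by_cases hd : T ∣ ω.length + 1
  · have hk : (ω.length + 1) / T = ω.length / T + 1 := by rw [Nat.succ_div, if_pos hd]
    rw [residual_of_length_eq hT (k := ω.length / T + 1)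
      (by rw [hlen, ← hk, Nat.div_mul_cancel hd])]
    simp only [age, hdel, hage, residual, hd, if_true]
    split_ifs <;> simp_all
  · have hk : (ω.length + 1) / T = ω.length / T := by rw [Nat.succ_div, if_neg hd, add_zero]
    simp only [residual, hlen, hk, hdel, hage, hd, if_false]
    split_ifs <;> simp_all

/-- The number of clients whose residual age is at least `x`. -/
noncomputable def level (T : ℕ) (h₁ : Fin M → ℕ) (ω : History M) (x : ℕ) : ℕ :=
  (Finset.univ.filter fun i => x ≤ residual T h₁ ω i).card

lemma level_append_of_ne (hT : 1 ≤ T) (ω : History M) (x : ℕ) {a : Slot M}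
    (ha : ∀ i, a ≠ (some i, true)) :
    level T h₁ (ω ++ [a]) (x + if T ∣ ω.length + 1 then 1 else 0) = level T h₁ ω x := by
  simp only [level, residual_append hT, ha, if_false, add_le_add_iff_right]

/-- The served client drops to residual age 0, below any threshold `x ≥ 1`. -/
lemma level_append_success (hT : 1 ≤ T) (ω : History M) {x : ℕ} (hx : 1 ≤ x) (i : Fin M) :
    level T h₁ (ω ++ [(some i, true)]) (x + if T ∣ ω.length + 1 then 1 else 0) =
      ((Finset.univ.filter fun j => x ≤ residual T h₁ ω j).erase i).card := by
  rw [level]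
  congr 1
  ext j
  simp only [residual_append hT, add_le_add_iff_right, Finset.mem_filter, Finset.mem_univ,
    true_and, Finset.mem_erase, Prod.mk.injEq, Option.some.injEq, and_true]
  by_cases h : i = j
  · simp only [h, if_true, ne_eq, not_true_eq_false, false_and, iff_false]
    omega
  · simp [h, Ne.symm h]

lemma level_one (hT : 1 ≤ T) (hh : ∀ i, 1 ≤ h₁ i) {ω : History M} {k : ℕ}
    (h : ω.length = k * T) : level T h₁ ω 1 = M := by
  simp [level, residual_of_length_eq hT h, one_le_age hh]

/-- Layer-cake formula; at a frame start residual ages are ages. -/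
lemma tsum_level (hT : 1 ≤ T) {ω : History M} {k : ℕ} (h : ω.length = k * T) :
    ∑' x : ℕ, (level T h₁ ω (x + 1) : ℝ≥0∞) = ∑ i, (age T h₁ ω k i : ℝ≥0∞) := by
  have hc : ∀ x : ℕ, (level T h₁ ω (x + 1) : ℝ≥0∞) =
      ∑ i, if x + 1 ≤ age T h₁ ω k i then 1 else 0 := fun x => by
    simp [level, residual_of_length_eq hT h]
  simp only [hc]
  rw [Summable.tsum_finsetSum fun _ _ => ENNReal.summable]
  refine Finset.sum_congr rfl fun i _ => ?_
  rw [tsum_eq_sum (s := Finset.range (age T h₁ ω k i)) fun x hx => by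
    rw [Finset.mem_range] at hx; rw [if_neg (by omega)]]
  rw [Finset.sum_congr rfl fun x hx => if_pos (by rw [Finset.mem_range] at hx; omega)]
  simp

end History

lemma IsGreedy.admissible {M T : ℕ} {h₁ : Fin M → ℕ} {G : Policy M} (hG : IsGreedy T h₁ G) :
    Admissible T G :=
  fun ω i hi => ((hG ω).1 i hi).1

namespace Network

variable {M T : ℕ} (N : Network M T)

/-! ### Expectations over histories -/

/-- The expectation of `f` over the histories of length `n` under the policy `π`. -/
noncomputable def expect (π : Policy M) (n : ℕ) (f : History M → ℝ≥0∞) : ℝ≥0∞ :=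
  ∑' ω, N.law π n ω * f ω

/-- The expectation of `f` over the histories that extend `ω` by one slot. -/
noncomputable def step (π : Policy M) (f : History M → ℝ≥0∞) (ω : History M) : ℝ≥0∞ :=
  ∑' a, π ω a * ∑ s, N.feedback a s * f (ω ++ [(a, s)])

lemma tsum_bind_mul {α β : Type*} (μ : PMF α) (κ : α → PMF β) (f : β → ℝ≥0∞) :
    ∑' b, μ.bind κ b * f b = ∑' a, μ a * ∑' b, κ a b * f b := by
  simp only [PMF.bind_apply, ← ENNReal.tsum_mul_right, ← ENNReal.tsum_mul_left]
  rw [ENNReal.tsum_comm]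
  simp only [mul_assoc]

lemma tsum_pure_mul {α : Type*} (a : α) (f : α → ℝ≥0∞) :
    ∑' b, PMF.pure a b * f b = f a := by
  rw [tsum_eq_single a fun b hb => by simp [PMF.pure_apply, hb]]
  simp

lemma tsum_map_mul {α β : Type*} (μ : PMF α) (g : α → β) (f : β → ℝ≥0∞) :
    ∑' b, μ.map g b * f b = ∑' a, μ a * f (g a) := by
  simp only [PMF.map, tsum_bind_mul, Function.comp_apply, tsum_pure_mul]

lemma expect_zero (π : Policy M) (f : History M → ℝ≥0∞) : N.expect π 0 f = f [] :=
  tsum_pure_mul _ _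

lemma expect_succ (π : Policy M) (n : ℕ) (f : History M → ℝ≥0∞) :
    N.expect π (n + 1) f = N.expect π n (N.step π f) := by
  simp only [expect, law, tsum_bind_mul, tsum_map_mul, step, tsum_fintype]

lemma length_of_law_ne_zero {π : Policy M} {n : ℕ} {ω : History M} (h : N.law π n ω ≠ 0) :
    ω.length = n := by
  induction n generalizing ω with
  | zero =>
    have h : ω ∈ (PMF.pure ([] : History M)).support := h
    simp_all
  | succ n ih =>
    have h : ω ∈ (N.law π (n + 1)).support := h
    simp only [law, PMF.mem_support_bind_iff, PMF.mem_support_map_iff] at h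
    obtain ⟨ω', hω', a, -, s, -, rfl⟩ := h
    simp [ih hω']

lemma expect_mono {π : Policy M} {n : ℕ} {f g : History M → ℝ≥0∞}
    (h : ∀ ω, ω.length = n → f ω ≤ g ω) : N.expect π n f ≤ N.expect π n g := by
  refine ENNReal.tsum_le_tsum fun ω => ?_
  by_cases hω : N.law π n ω = 0
  · simp [hω]
  · gcongr
    exact h ω (N.length_of_law_ne_zero hω)

lemma expect_congr {π : Policy M} {n : ℕ} {f g : History M → ℝ≥0∞}
    (h : ∀ ω, ω.length = n → f ω = g ω) : N.expect π n f = N.expect π n g :=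
  le_antisymm (N.expect_mono fun ω hω => (h ω hω).le) (N.expect_mono fun ω hω => (h ω hω).ge)

lemma expect_const (π : Policy M) (n : ℕ) (c : ℝ≥0∞) : N.expect π n (fun _ => c) = c := by
  rw [expect, ENNReal.tsum_mul_right, PMF.tsum_coe, one_mul]

lemma expect_const_mul (π : Policy M) (n : ℕ) (c : ℝ≥0∞) (f : History M → ℝ≥0∞) :
    N.expect π n (fun ω => c * f ω) = c * N.expect π n f := by
  simp only [expect, ← ENNReal.tsum_mul_left, mul_left_comm]

lemma expect_add (π : Policy M) (n : ℕ) (f g : History M → ℝ≥0∞) :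
    N.expect π n (fun ω => f ω + g ω) = N.expect π n f + N.expect π n g := by
  simp only [expect, mul_add, ENNReal.tsum_add]

lemma expect_sum {ι : Type*} (s : Finset ι) (π : Policy M) (n : ℕ)
    (f : ι → History M → ℝ≥0∞) :
    N.expect π n (fun ω => ∑ j ∈ s, f j ω) = ∑ j ∈ s, N.expect π n (f j) := by
  simp only [expect, Finset.mul_sum]
  exact Summable.tsum_finsetSum fun _ _ => ENNReal.summable

lemma expect_tsum {ι : Type*} (π : Policy M) (n : ℕ) (f : ι → History M → ℝ≥0∞) :
    N.expect π n (fun ω => ∑' j, f j ω) = ∑' j, N.expect π n (f j) := by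
  simp only [expect, ← ENNReal.tsum_mul_left]
  exact ENNReal.tsum_comm

lemma sum_feedback (a : Option (Fin M)) : ∑ s, N.feedback a s = 1 := by
  rw [← tsum_fintype (L := .unconditional _), PMF.tsum_coe]

/-- A quantity settled after `m` slots keeps its expectation; this lets the age of frame `k` be
evaluated at time `k * T`. -/
lemma expect_add_of_append_eq {π : Policy M} {m : ℕ} {f : History M → ℝ≥0∞}
    (h : ∀ ω l : History M, m ≤ ω.length → f (ω ++ l) = f ω) (n : ℕ) :
    N.expect π (m + n) f = N.expect π m f := by
  induction n with
  | zero => rfl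
  | succ n ih =>
    rw [← add_assoc, expect_succ, ← ih]
    refine N.expect_congr fun ω hω => ?_
    simp only [step, h ω _ (hω ▸ Nat.le_add_right m n), ← Finset.sum_mul, sum_feedback, one_mul,
      ENNReal.tsum_mul_right, PMF.tsum_coe]

/-! ### Evolution of the levels -/

lemma feedback_true (i : Fin M) : N.feedback (some i) true = ENNReal.ofReal (N.p i) := by
  simp [feedback]

lemma feedback_false (i : Fin M) : N.feedback (some i) false = 1 - ENNReal.ofReal (N.p i) := by
  rw [← ENNReal.ofReal_one, ← ENNReal.ofReal_sub _ (N.p_pos i).le]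
  simp [feedback]

variable {h₁ : Fin M → ℕ} {p : ℝ}

lemma deficit_level_le_step (hT : 1 ≤ T) (hp : ∀ i, N.p i = p) (hp₁ : p ≤ 1) (π : Policy M)
    (m : ℕ) {x : ℕ} (hx : 1 ≤ x) (ω : History M) :
    deficit (ENNReal.ofReal p) (m + 1) (level T h₁ ω x) ≤
      N.step π (fun ω' => deficit (ENNReal.ofReal p) m
        (level T h₁ ω' (x + if T ∣ ω.length + 1 then 1 else 0))) ω := by
  have hq : ENNReal.ofReal p ≤ 1 := by simpa using hp₁
  set q := ENNReal.ofReal p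
  -- The left side becomes an average over the next decision, so that decisions can be compared one
  -- by one.
  rw [step, ← one_mul (deficit q (m + 1) _), ← PMF.tsum_coe (π ω), ← ENNReal.tsum_mul_right]
  refine ENNReal.tsum_le_tsum fun a => ?_
  gcongr
  rw [Fintype.sum_bool]
  cases a with
  | none =>
    rw [level_append_of_ne hT ω x (a := (none, false)) (by simp)]
    simpa [feedback] using deficit_succ_le hq m _
  | some i =>
    rw [level_append_of_ne hT ω x (a := (some i, false)) (by simp), level_append_success hT ω hx,
      feedback_true, feedback_false, hp, deficit]
    gcongr
    exact deficit_mono q m Finset.pred_card_le_card_erase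

/-- Both losses in the general inequality vanish: Greedy idles only when the level is zero, and
otherwise its client lies in the level set unless that set is empty. -/
lemma step_deficit_level (hT : 1 ≤ T) (hp : ∀ i, N.p i = p)
    {G : Policy M} (hG : IsGreedy T h₁ G) (m : ℕ) {x : ℕ} (hx : 1 ≤ x) (ω : History M) :
    N.step G (fun ω' => deficit (ENNReal.ofReal p) m
        (level T h₁ ω' (x + if T ∣ ω.length + 1 then 1 else 0))) ω =
      deficit (ENNReal.ofReal p) (m + 1) (level T h₁ ω x) := by
  set q := ENNReal.ofReal p
  rw [step, ← one_mul (deficit q (m + 1) _), ← PMF.tsum_coe (G ω), ← ENNReal.tsum_mul_right]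
  refine tsum_congr fun a => ?_
  by_cases ha : G ω a = 0
  · simp [ha]
  congr 1
  rw [Fintype.sum_bool]
  cases a with
  | none =>
    have hdel := (hG ω).2 ha
    have h0 : level T h₁ ω x = 0 := by
      simp only [level, residual, hdel, if_true, Finset.card_eq_zero]
      exact Finset.filter_eq_empty_iff.2 fun _ _ => by omega
    rw [level_append_of_ne hT ω x (a := (none, false)) (by simp), h0]
    simp [feedback]
  | some i =>
    obtain ⟨hi, hmax⟩ := (hG ω).1 i ha
    rw [level_append_of_ne hT ω x (a := (some i, false)) (by simp), level_append_success hT ω hx,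
      feedback_true, feedback_false, hp, deficit]
    congr 3
    -- For an empty level set erasing changes nothing, which agrees with truncated `0 - 1 = 0`.
    by_cases h0 : level T h₁ ω x = 0
    · rw [h0]
      rw [level, Finset.card_eq_zero] at h0
      simp [h0]
    obtain ⟨j, hj⟩ := Finset.card_pos.1 (Nat.pos_of_ne_zero h0)
    refine Finset.card_erase_of_mem ?_
    rw [Finset.mem_filter] at hj ⊢
    refine ⟨Finset.mem_univ i, hj.2.trans ?_⟩
    rw [residual, residual, if_neg hi]
    split_ifs with hjd
    · exact Nat.zero_le _
    · exact hmax j hjd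

lemma expect_deficit_level_le (hT : 1 ≤ T) (hp : ∀ i, N.p i = p) (hp₁ : p ≤ 1) (π : Policy M)
    {y : ℕ} (hy : 1 ≤ y) (k n m : ℕ) :
    N.expect π (k * T) (fun ω => deficit (ENNReal.ofReal p) (m + n) (level T h₁ ω y)) ≤
      N.expect π (k * T + n)
        (fun ω => deficit (ENNReal.ofReal p) m (level T h₁ ω (y + n / T))) := by
  induction n generalizing m with
  | zero => simp
  | succ n ih =>
    rw [← add_assoc (k * T), expect_succ, ← add_assoc m, add_right_comm m]
    refine (ih (m + 1)).trans (N.expect_mono fun ω hω => ?_)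
    refine (N.deficit_level_le_step hT hp hp₁ π m (hy.trans (Nat.le_add_right _ _)) ω).trans_eq ?_
    -- Frame boundaries are those counted from slot `k * T`, so the threshold has risen by `n / T`
    -- after `n` slots.
    have hd : T ∣ ω.length + 1 ↔ T ∣ n + 1 := by
      rw [hω, add_assoc]; exact Nat.dvd_add_right (Dvd.intro_left k rfl)
    simp only [hd, Nat.succ_div, add_assoc]

lemma expect_deficit_level (hT : 1 ≤ T) (hp : ∀ i, N.p i = p)
    {G : Policy M} (hG : IsGreedy T h₁ G) {y : ℕ} (hy : 1 ≤ y) (k n m : ℕ) :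
    N.expect G (k * T + n)
        (fun ω => deficit (ENNReal.ofReal p) m (level T h₁ ω (y + n / T))) =
      N.expect G (k * T) (fun ω => deficit (ENNReal.ofReal p) (m + n) (level T h₁ ω y)) := by
  induction n generalizing m with
  | zero => simp
  | succ n ih =>
    rw [← add_assoc (k * T), expect_succ, ← add_assoc m, add_right_comm m, ← ih (m + 1)]
    refine N.expect_congr fun ω hω => ?_
    rw [← N.step_deficit_level hT hp hG m (hy.trans (Nat.le_add_right _ _)) ω]
    have hd : T ∣ ω.length + 1 ↔ T ∣ n + 1 := by
      rw [hω, add_assoc]; exact Nat.dvd_add_right (Dvd.intro_left k rfl)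
    simp only [hd, Nat.succ_div, add_assoc]

/-- The expected number of clients of age more than `x` at the beginning of frame `k` under a
Greedy policy. -/
noncomputable def greedyLevel (T : ℕ) (h₁ : Fin M → ℕ) (p : ℝ) (k x : ℕ) : ℝ≥0∞ :=
  if x < k then deficit (ENNReal.ofReal p) (x * T) M
  else deficit (ENNReal.ofReal p) (k * T) (level T h₁ [] (x - k + 1))

lemma greedyLevel_le_expect_level (hT : 1 ≤ T) (hp : ∀ i, N.p i = p) (hp₁ : p ≤ 1)
    (hh : ∀ i, 1 ≤ h₁ i) (π : Policy M) (k x : ℕ) :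
    greedyLevel T h₁ p k x ≤ N.expect π (k * T) fun ω => (level T h₁ ω (x + 1) : ℝ≥0∞) := by
  rw [greedyLevel]
  split_ifs with h
  · have := N.expect_deficit_level_le (h₁ := h₁) hT hp hp₁ π le_rfl (k - x) (x * T) 0
    rw [N.expect_congr (g := fun _ => deficit (ENNReal.ofReal p) (x * T) M)
      fun ω hω => by rw [level_one hT hh hω, zero_add], expect_const, ← add_mul,
      Nat.sub_add_cancel h.le, Nat.mul_div_cancel _ hT, add_comm 1] at this
    exact this
  · have := N.expect_deficit_level_le (h₁ := h₁) hT hp hp₁ π (y := x - k + 1) (by omega) 0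
      (k * T) 0
    simp only [zero_mul, expect_zero, zero_add] at this
    rw [Nat.mul_div_cancel _ hT,
      show x - k + 1 + k = x + 1 by omega] at this
    exact this

lemma expect_level_of_isGreedy (hT : 1 ≤ T) (hp : ∀ i, N.p i = p)
    (hh : ∀ i, 1 ≤ h₁ i) {G : Policy M} (hG : IsGreedy T h₁ G) (k x : ℕ) :
    N.expect G (k * T) (fun ω => (level T h₁ ω (x + 1) : ℝ≥0∞)) = greedyLevel T h₁ p k x := by
  rw [greedyLevel]
  split_ifs with h
  · have := N.expect_deficit_level hT hp hG le_rfl (k - x) (x * T) 0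
    rw [N.expect_congr (π := G) (n := (k - x) * T)
      (g := fun _ => deficit (ENNReal.ofReal p) (x * T) M)
      fun ω hω => by rw [level_one hT hh hω, zero_add], expect_const, ← add_mul,
      Nat.sub_add_cancel h.le, Nat.mul_div_cancel _ hT, add_comm 1] at this
    exact this
  · have := N.expect_deficit_level hT hp hG (y := x - k + 1) (by omega) 0 (k * T) 0
    simp only [zero_mul, expect_zero, zero_add] at this
    rw [Nat.mul_div_cancel _ hT,
      show x - k + 1 + k = x + 1 by omega] at this
    exact this

lemma tendsto_tsum_greedyLevel (hT : 1 ≤ T) (hp₀ : 0 < p) (hp₁ : p ≤ 1) (h₁ : Fin M → ℕ) :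
    Tendsto (fun k => ∑' x, greedyLevel T h₁ p k x) atTop
      (𝓝 (∑' j, deficit (ENNReal.ofReal p) (j * T) M)) := by
  have hq : ENNReal.ofReal p ≤ 1 := by simpa using hp₁
  have hq₀ : ENNReal.ofReal p ≠ 0 := by simpa using hp₀
  have hS := tsum_deficit_mul_ne_top hq₀ hq M hT
  set q := ENNReal.ofReal p
  have hsplit : ∀ k, ∑' x, greedyLevel T h₁ p k x =
      ∑ x ∈ Finset.range k, deficit q (x * T) M +
        ∑' y, deficit q (k * T) (level T h₁ [] (y + 1)) := fun k => by
    rw [← ENNReal.summable.sum_add_tsum_nat_add' (k := k)]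
    congr 1
    · exact Finset.sum_congr rfl fun x hx => if_pos (Finset.mem_range.1 hx)
    · exact tsum_congr fun y => by rw [greedyLevel, if_neg (by omega), Nat.add_sub_cancel]
  simp only [hsplit]
  -- The partial sums of deficits give the limit; the contribution of the initial vector must
  -- vanish.
  rw [← add_zero (∑' j, deficit q (j * T) M)]
  refine ENNReal.summable.hasSum.tendsto_sum_nat.add ?_
  have hbound : ∀ k, ∑' y, deficit q (k * T) (level T h₁ [] (y + 1)) ≤
      (∑ i, h₁ i : ℕ) * deficit q (k * T) M := fun k => by
    rw [tsum_eq_sum (s := Finset.range (∑ i, h₁ i)) fun y hy => ?_]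
    · refine (Finset.sum_le_card_nsmul _ _ (deficit q (k * T) M) fun y _ =>
        deficit_mono q _ ?_).trans_eq (by simp)
      exact (Finset.card_filter_le _ _).trans_eq (by simp)
    -- Thresholds above the sum of the initial ages exceed each of them, so only finitely many terms
    -- survive.
    · have h0 : level T h₁ [] (y + 1) = 0 := by
        rw [level, Finset.card_eq_zero, Finset.filter_eq_empty_iff]
        intro i _
        rw [residual_nil]
        have := Finset.single_le_sum (f := h₁) (fun _ _ => Nat.zero_le _) (Finset.mem_univ i)
        rw [Finset.mem_range] at hy
        omega
      rw [h0, deficit_zero_right]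
  refine tendsto_of_tendsto_of_tendsto_of_le_of_le tendsto_const_nhds ?_
    (fun _ => zero_le) hbound
  rw [← mul_zero ((∑ i, h₁ i : ℕ) : ℝ≥0∞)]
  exact ENNReal.Tendsto.const_mul (ENNReal.tendsto_atTop_zero_of_tsum_ne_top hS)
    (Or.inr (ENNReal.natCast_ne_top _))

/-! ### The age of information of symmetric networks -/

variable {α : ℝ}

lemma ofReal_sumAoI (hα : ∀ i, N.α i = α) (hα₀ : 0 ≤ α) (h₁ : Fin M → ℕ) (K : ℕ)
    (ω : History M) :
    ENNReal.ofReal (N.sumAoI h₁ K ω) =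
      ENNReal.ofReal (1 / (K * T * M)) * ∑ k ∈ Finset.range K,
        (ENNReal.ofReal (α * (T ^ 2 / 2) * M) +
          ENNReal.ofReal (α * T ^ 2) * ∑ i, (age T h₁ ω k i : ℝ≥0∞)) := by
  rw [sumAoI, ENNReal.ofReal_mul (by positivity),
    ENNReal.ofReal_sum_of_nonneg fun k _ => Finset.sum_nonneg fun i _ => by
      rw [hα]; positivity]
  congr 1
  refine Finset.sum_congr rfl fun k _ => ?_
  have h : ∑ i, N.α i * ((T : ℝ) ^ 2 / 2 + (T : ℝ) ^ 2 * age T h₁ ω k i) =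
      α * (T ^ 2 / 2) * M + α * T ^ 2 * ((∑ i, age T h₁ ω k i : ℕ) : ℝ) := by
    simp only [hα, mul_add, Finset.sum_add_distrib, Finset.sum_const, Finset.card_univ,
      Fintype.card_fin, nsmul_eq_mul, Nat.cast_sum, Finset.mul_sum]
    congr 1
    · ring
    · exact Finset.sum_congr rfl fun _ _ => by ring
  rw [h, ENNReal.ofReal_add (by positivity) (by positivity), ENNReal.ofReal_mul (by positivity :
    (0 : ℝ) ≤ α * T ^ 2), ENNReal.ofReal_natCast, Nat.cast_sum]

lemma EWSAoI_eq (hT : 1 ≤ T) (hα : ∀ i, N.α i = α) (hα₀ : 0 ≤ α) (h₁ : Fin M → ℕ)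
    (π : Policy M) (K : ℕ) :
    N.EWSAoI h₁ π K =
      ENNReal.ofReal (1 / (K * T * M)) * ∑ k ∈ Finset.range K,
        (ENNReal.ofReal (α * (T ^ 2 / 2) * M) + ENNReal.ofReal (α * T ^ 2) *
          ∑' x : ℕ, N.expect π (k * T) fun ω => (level T h₁ ω (x + 1) : ℝ≥0∞)) := by
  change N.expect π (K * T) _ = _
  simp only [N.ofReal_sumAoI hα hα₀, expect_const_mul, expect_sum, expect_add, expect_const]
  congr 1
  refine Finset.sum_congr rfl fun k hk => ?_
  congr 2
  rw [← expect_sum, ← expect_tsum]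
  obtain ⟨n, rfl⟩ := Nat.exists_eq_add_of_le (Finset.mem_range.1 hk).le
  rw [add_mul, N.expect_add_of_append_eq fun ω l hω => by simp only [age_append hω]]
  exact N.expect_congr fun ω hω => (tsum_level hT hω).symm

lemma EWSAoI_le_of_isGreedy (hT : 1 ≤ T) (hα : ∀ i, N.α i = α) (hα₀ : 0 ≤ α)
    (hp : ∀ i, N.p i = p) (hp₁ : p ≤ 1) (hh : ∀ i, 1 ≤ h₁ i) {G : Policy M}
    (hG : IsGreedy T h₁ G) (π : Policy M) (K : ℕ) : N.EWSAoI h₁ G K ≤ N.EWSAoI h₁ π K := by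
  rw [N.EWSAoI_eq hT hα hα₀, N.EWSAoI_eq hT hα hα₀]
  gcongr with k _ x
  rw [N.expect_level_of_isGreedy hT hp hh hG]
  exact N.greedyLevel_le_expect_level hT hp hp₁ hh π k x

lemma tendsto_EWSAoI_of_isGreedy (hT : 1 ≤ T) (hα : ∀ i, N.α i = α) (hα₀ : 0 ≤ α)
    (hp : ∀ i, N.p i = p) (hp₀ : 0 < p) (hp₁ : p ≤ 1) (hh : ∀ i, 1 ≤ h₁ i) {G : Policy M}
    (hG : IsGreedy T h₁ G) :
    Tendsto (fun K => N.EWSAoI h₁ G K) atTop (𝓝 (ENNReal.ofReal (1 / (T * M) *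
      (α * (T ^ 2 / 2) * M +
        α * T ^ 2 * (∑' j, deficit (ENNReal.ofReal p) (j * T) M).toReal)))) := by
  have hq : ENNReal.ofReal p ≤ 1 := by simpa using hp₁
  have hq₀ : ENNReal.ofReal p ≠ 0 := by simpa using hp₀
  have hS := tsum_deficit_mul_ne_top hq₀ hq M hT
  have hlim := tendsto_tsum_greedyLevel hT hp₀ hp₁ h₁
  have hfin : ∀ k, ∑' x, greedyLevel T h₁ p k x ≠ ⊤ := fun k => by
    simp only [← N.expect_level_of_isGreedy hT hp hh hG]
    rw [← expect_tsum, N.expect_congr fun ω hω => tsum_level hT hω]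
    have hage : ∀ (ω : History M) i, age T h₁ ω k i ≤ h₁ i + k := fun ω i => by
      induction k with
      | zero => exact le_rfl
      | succ k ih => simp only [age]; split_ifs <;> omega
    refine ne_top_of_le_ne_top (ENNReal.natCast_ne_top (∑ i, (h₁ i + k)))
      ((N.expect_mono fun ω _ => ?_).trans_eq (N.expect_const G (k * T) _))
    exact_mod_cast Finset.sum_le_sum fun i _ => hage ω i
  have hreal : Tendsto (fun k => α * (T ^ 2 / 2) * M +
      α * T ^ 2 * (∑' x, greedyLevel T h₁ p k x).toReal) atTop (𝓝 (α * (T ^ 2 / 2) * M +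
      α * T ^ 2 * (∑' j, deficit (ENNReal.ofReal p) (j * T) M).toReal)) :=
    (((ENNReal.tendsto_toReal hS).comp hlim).const_mul _).const_add _
  -- The per-frame cost converges, hence so do its Cesàro means.
  refine (ENNReal.tendsto_ofReal (hreal.cesaro.const_mul (1 / ((T : ℝ) * M)))).congr fun K => ?_
  rw [N.EWSAoI_eq hT hα hα₀]
  simp only [N.expect_level_of_isGreedy hT hp hh hG]
  rw [← mul_assoc, ENNReal.ofReal_mul (by positivity),
    ENNReal.ofReal_sum_of_nonneg fun k _ => by positivity]
  congr 1
  · congr 1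
    simp only [one_div, mul_inv]
    ring
  · refine Finset.sum_congr rfl fun k _ => ?_
    rw [ENNReal.ofReal_add (by positivity) (by positivity), ENNReal.ofReal_mul (by positivity :
      (0 : ℝ) ≤ α * T ^ 2), ENNReal.ofReal_toReal (hfin k)]

/-- In a symmetric network, Greedy policies attain a finite positive limit of the expected
weighted sum age of information, and no policy does better. -/
lemma greedy_optimal (hT : 1 ≤ T) (hM : 1 ≤ M) (hN : N.IsSymmetric)
    (hh : ∀ i, 1 ≤ h₁ i) {G : Policy M} (hG : IsGreedy T h₁ G) :
    Tendsto (fun K => N.EWSAoI h₁ G K) atTop (𝓝 (N.EWSAoILim h₁ G)) ∧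
      N.EWSAoILim h₁ G ≠ ⊤ ∧ N.EWSAoILim h₁ G ≠ 0 ∧
      ∀ π : Policy M, N.EWSAoILim h₁ G ≤ N.EWSAoILim h₁ π := by
  set i₀ : Fin M := ⟨0, hM⟩
  have hα : ∀ i, N.α i = N.α i₀ := fun i => hN.1 i i₀
  have hp : ∀ i, N.p i = N.p i₀ := fun i => hN.2 i i₀
  have hα₀ := N.α_pos i₀
  have hlim := N.tendsto_EWSAoI_of_isGreedy hT hα hα₀.le hp (N.p_pos i₀) (N.p_le_one i₀) hh hG
  rw [show N.EWSAoILim h₁ G = _ from hlim.liminf_eq]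
  refine ⟨hlim, ENNReal.ofReal_ne_top, ?_, fun π => ?_⟩
  · have hT' : (0 : ℝ) < T := by exact_mod_cast hT
    have hM' : (0 : ℝ) < M := by exact_mod_cast hM
    rw [ne_eq, ENNReal.ofReal_eq_zero, not_le]
    positivity
  · rw [← hlim.liminf_eq]
    exact liminf_le_liminf (Eventually.of_forall fun K =>
      N.EWSAoI_le_of_isGreedy hT hα hα₀.le hp (N.p_le_one i₀) hh hG π K)

/-! ### The performance guarantee -/

lemma varInv_eq_zero_iff (hM : 1 ≤ M) : N.varInv = 0 ↔ ∀ j, 1 / N.p j = N.meanInv := by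
  have hM' : (M : ℝ) ≠ 0 := by exact_mod_cast (by omega : M ≠ 0)
  rw [varInv, mul_eq_zero, or_iff_right (one_div_ne_zero hM'),
    Finset.sum_eq_zero_iff_of_nonneg fun _ _ => sq_nonneg _]
  simp [sub_eq_zero]

lemma rhoG_eq_one_iff (hM : 1 ≤ M) (hT : 1 ≤ T) : N.rhoG = 1 ↔ N.IsSymmetric := by
  set i₀ : Fin M := ⟨0, hM⟩
  have hne : (Finset.univ : Finset (Fin M)).Nonempty := ⟨i₀, Finset.mem_univ _⟩
  have hM' : (0 : ℝ) < M := by exact_mod_cast hM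
  have hT' : (0 : ℝ) < T := by exact_mod_cast hT
  have hA : 0 < ∑ i, N.α i := Finset.sum_pos (fun i _ => N.α_pos i) hne
  have hB : 0 < ∑ i, 1 / N.p i := Finset.sum_pos (fun i _ => one_div_pos.2 (N.p_pos i)) hne
  rw [rhoG, div_eq_one_iff_eq (by positivity), add_left_inj]
  constructor
  · intro h
    have hcs : (∑ i, √(N.α i / N.p i)) ^ 2 ≤ (∑ i, N.α i) * ∑ i, 1 / N.p i := by
      refine Finset.sum_sq_le_sum_mul_sum_of_sq_le_mul _ (fun i _ => (N.α_pos i).le)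
        (fun i _ => (one_div_pos.2 (N.p_pos i)).le) fun i _ => ?_
      exact (by rw [Real.sq_sqrt (div_pos (N.α_pos i) (N.p_pos i)).le, mul_one_div] :
        √(N.α i / N.p i) ^ 2 = N.α i * (1 / N.p i)).le
    -- By Cauchy–Schwarz a positive `CV` would make the numerator exceed the denominator.
    have hCV : N.CV = 0 := by
      have h₂ : N.CV ^ 2 / M ≤ 0 := by
        by_contra! hpos
        nlinarith [mul_pos (mul_pos hA hB) hpos]
      have h₃ : N.CV ^ 2 / M = 0 := le_antisymm h₂ (by positivity)
      simpa [hM'.ne'] using h₃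
    have hmean : 0 < N.meanInv := by unfold meanInv; positivity
    have hvar : N.varInv = 0 := by
      have hv : 0 ≤ N.varInv := by unfold varInv; positivity
      rw [CV, div_eq_zero_iff, or_iff_left hmean.ne', Real.sqrt_eq_zero hv] at hCV
      exact hCV
    have hinv := (N.varInv_eq_zero_iff hM).1 hvar
    have hp : ∀ i j, N.p i = N.p j := fun i j => by
      have := (hinv i).trans (hinv j).symm
      simpa using this
    refine ⟨?_, hp⟩
    have hp₀ := N.p_pos i₀
    simp only [hp _ i₀, Real.sqrt_div (N.α_pos _).le, ← Finset.sum_div, hCV, div_pow,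
      Real.sq_sqrt hp₀.le, Finset.sum_const, Finset.card_univ, Fintype.card_fin,
      nsmul_eq_mul] at h
    have hS : (∑ i, √(N.α i)) ^ 2 = (∑ i, N.α i) * M := by
      field_simp at h
      linarith
    -- With all `p` equal, `h` says that the square roots of the weights have zero variance.
    have hzero : ∑ i, (√(N.α i) - (∑ j, √(N.α j)) / M) ^ 2 = 0 := by
      simp only [sub_sq, Finset.sum_add_distrib, Finset.sum_sub_distrib, Real.sq_sqrt (N.α_pos _).le,
        ← Finset.sum_mul, ← Finset.mul_sum, Finset.sum_const, Finset.card_univ, Fintype.card_fin,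
        nsmul_eq_mul]
      field_simp
      linarith
    rw [Finset.sum_eq_zero_iff_of_nonneg fun _ _ => sq_nonneg _] at hzero
    have hs : ∀ i, √(N.α i) = (∑ j, √(N.α j)) / M := fun i =>
      sub_eq_zero.1 (pow_eq_zero_iff two_ne_zero |>.1 (hzero i (Finset.mem_univ i)))
    intro i j
    rw [← Real.sq_sqrt (N.α_pos i).le, ← Real.sq_sqrt (N.α_pos j).le, hs i, hs j]
  · rintro ⟨hα, hp⟩
    have hvar : N.varInv = 0 := (N.varInv_eq_zero_iff hM).2 fun j => by
      simp only [meanInv, hp _ j, Finset.sum_const, Finset.card_univ, Fintype.card_fin,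
        nsmul_eq_mul]
      field_simp
    have hr := div_pos (N.α_pos i₀) (N.p_pos i₀)
    have hp₀ := N.p_pos i₀
    simp only [CV, hvar, hα _ i₀, hp _ i₀, Finset.sum_const, Finset.card_univ, Fintype.card_fin,
      nsmul_eq_mul, mul_pow, Real.sq_sqrt hr.le]
    simp
    field_simp

end Network

end AoI

theorem mainTheorem9 :
    -- the guarantee equals one exactly for symmetric networks
    (∀ (M T : ℕ) (_ : 1 ≤ M) (_ : 1 ≤ T) (N : AoI.Network M T),
      N.rhoG = 1 ↔ N.IsSymmetric) ∧
    -- Greedy minimizes the infinite-horizon expected sum AoI of every symmetric network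
    (∀ (M T : ℕ) (_ : 1 ≤ M) (_ : 1 ≤ T) (N : AoI.Network M T) (_ : N.IsSymmetric)
      (h₁ : Fin M → ℕ) (_ : ∀ i, 1 ≤ h₁ i) (G : AoI.Policy M) (_ : AoI.IsGreedy T h₁ G),
      AoI.Admissible T G ∧
      Tendsto (fun K => N.EWSAoI h₁ G K) atTop (𝓝 (N.EWSAoILim h₁ G)) ∧
      N.EWSAoILim h₁ G ≠ ⊤ ∧
      ∀ π : AoI.Policy M, AoI.Admissible T π → N.EWSAoILim h₁ G ≤ N.EWSAoILim h₁ π) ∧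
    -- its optimality ratio tends to one as the number of clients tends to infinity
    (∀ (T : ℕ) (_ : 1 ≤ T) (p α : ℝ) (N : (M : ℕ) → AoI.Network M T)
      (_ : ∀ M i, (N M).p i = p) (_ : ∀ M i, (N M).α i = α)
      (h₁ : (M : ℕ) → Fin M → ℕ) (_ : ∀ M i, 1 ≤ h₁ M i)
      (G : (M : ℕ) → AoI.Policy M) (_ : ∀ M, AoI.IsGreedy T (h₁ M) (G M)),
      Tendsto (fun M => (N M).EWSAoILim (h₁ M) (G M) / (N M).optEWSAoI (h₁ M)) atTop (𝓝 1)) := by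
  refine ⟨fun M T hM hT N => N.rhoG_eq_one_iff hM hT, ?_, ?_⟩
  · intro M T hM hT N hN h₁ hh G hG
    obtain ⟨hlim, hfin, -, hopt⟩ := N.greedy_optimal hT hM hN hh hG
    exact ⟨hG.admissible, hlim, hfin, fun π _ => hopt π⟩
  · intro T hT p α N hp hα h₁ hh G hG
    refine tendsto_const_nhds.congr' ?_
    filter_upwards [eventually_ge_atTop 1] with M hM
    obtain ⟨-, hfin, hpos, hopt⟩ := (N M).greedy_optimal hT hM
      ⟨fun i j => by rw [hα, hα], fun i j => by rw [hp, hp]⟩ (hh M) (hG M)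
    have hopt_eq : (N M).optEWSAoI (h₁ M) = (N M).EWSAoILim (h₁ M) (G M) :=
      le_antisymm (iInf₂_le _ (hG M).admissible) (le_iInf₂ fun π _ => hopt π)
    rw [hopt_eq, ENNReal.div_self hpos hfin]
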